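/- Let $\mathcal{H}=\mathbb{C}^d$ with $d\ge 1$. A POVM on a finite-dimensional Hilbert space is a finite collection $\{A_j\}_j$ of positive semidefinite operators that sum to the identity; it is simple if its elements are pairwise linearly independent. A SIC on $\mathcal{H}$ is a POVM composed of $d^2$ elements of the form $\frac1d|\psi_j\rangle\langle\psi_j|$, $j=1,\dots,d^2$, with $|\langle\psi_j|\psi_k\rangle|^2=\frac{d\,\delta_{jk}+1}{d+1}$ for all $j,k$. For a POVM $\mathscr{C}=\{C_j\}_j$ on $\mathcal{H}^{\otimes N}$, the estimation fidelity is $$F(\mathscr{C})=\max_{\{\hat\rho_j\}}\ \sum_j\int \operatorname{tr}(\rho^{\otimes N}C_j)\,\operatorname{tr}(\rho\hat\rho_j)\,d\mu(\psi),\qquad \rho=|\psi\rangle\langle\psi|,$$ where $\mu$ is the normalized measure on the pure states of $\mathcal{H}$ induced by the Haar measure on the unitary group, and the maximum is over all choices of one density operator $\hat\rho_j$ on $\mathcal{H}$ for each outcome $j$. For POVMs $\mathscr{A}=\{A_j\}_j$ and $\mathscr{B}=\{B_k\}_k$ on $\mathcal{H}$ let $\mathscr{A}\otimes\mathscr{B}=\{A_j\otimes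 B_k\}_{j,k}$, $\mathscr{A}^{\otimes 2}=\mathscr{A}\otimes\mathscr{A}$, and let $$F_2^{\mathrm{iid}}=\frac{2\left[d^2+d+1+(d-1)\sqrt{d+1}\right]}{d(d+1)(d+2)}.$$ Two simple POVMs $\mathscr{A}$ and $\mathscr{B}$ on $\mathcal{H}$ are identical SICs up to relabeling (that is, both are SICs and they coincide after a bijective relabeling of their elements) if and only if $$F(\mathscr{A}\otimes\mathscr{B})=F(\mathscr{A}^{\otimes 2})=F_2^{\mathrm{iid}}.$$ -/

import Mathlib

namespace QMeas

open Matrix MeasureTheory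
open scoped Kronecker ComplexOrder

/-- A POVM with finitely many outcomes, labelled by `ι`, on the Hilbert space with orthonormal
basis labelled by `n`: a finite collection of positive semidefinite operators that sum up to the
identity. -/
structure POVM (n ι : Type*) [Fintype n] [DecidableEq n] [Fintype ι] where
  /-- the POVM elements -/
  elem : ι → Matrix n n ℂ
  posSemidef : ∀ j, (elem j).PosSemidef
  sum_eq_one : ∑ j, elem j = 1

/-- A POVM is simple if its elements are pairwise linearly independent. -/
def POVM.IsSimple {n ι : Type*} [Fintype n] [DecidableEq n] [Fintype ι] (A : POVM n ι) : Prop :=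
  Pairwise fun j k => LinearIndependent ℂ ![A.elem j, A.elem k]

/-- Two POVMs are identical up to relabeling of the outcomes. -/
def POVM.IdenticalUpToRelabeling {n ι κ : Type*} [Fintype n] [DecidableEq n] [Fintype ι]
    [Fintype κ] (A : POVM n ι) (B : POVM n κ) : Prop :=
  ∃ e : ι ≃ κ, ∀ j, A.elem j = B.elem (e j)

open Classical in
/-- A POVM on `ℂ^d` is a SIC if it consists of `d ^ 2` elements `(1 / d) |ψ_j⟩⟨ψ_j|` with
`|⟨ψ_j|ψ_k⟩|² = (d δ_jk + 1) / (d + 1)` for all `j`, `k`. -/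
def POVM.IsSIC {d : ℕ} {ι : Type*} [Fintype ι] (A : POVM (Fin d) ι) : Prop :=
  Fintype.card ι = d ^ 2 ∧
    ∃ ψ : ι → Fin d → ℂ,
      (∀ j, A.elem j = ((1 : ℂ) / (d : ℂ)) • vecMulVec (ψ j) (star (ψ j))) ∧
      ∀ j k, ‖star (ψ j) ⬝ᵥ ψ k‖ ^ 2 = ((d : ℝ) * (if j = k then 1 else 0) + 1) / ((d : ℝ) + 1)

/-- The product POVM `A ⊗ B = {A_j ⊗ B_k}` on two copies of `ℂ^d`; the product basis of
`ℂ^d ⊗ ℂ^d` is labelled by the functions `Fin 2 → Fin d`. -/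
noncomputable def POVM.prod {d : ℕ} {ι κ : Type*} [Fintype ι] [Fintype κ]
    (A : POVM (Fin d) ι) (B : POVM (Fin d) κ) : POVM (Fin 2 → Fin d) (ι × κ) where
  elem p := (A.elem p.1 ⊗ₖ B.elem p.2).submatrix
    (fun x : Fin 2 → Fin d => (x 0, x 1)) (fun x : Fin 2 → Fin d => (x 0, x 1))
  posSemidef p := ((A.posSemidef p.1).kronecker (B.posSemidef p.2)).submatrix _
  sum_eq_one := by
    ext x y
    have hA := congrFun (congrFun A.sum_eq_one (x 0)) (y 0)
    have hB := congrFun (congrFun B.sum_eq_one (x 1)) (y 1)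
    rw [Matrix.sum_apply] at hA hB
    simp only [Matrix.sum_apply, submatrix_apply, kroneckerMap_apply,
      Fintype.sum_prod_type, ← Finset.mul_sum, ← Finset.sum_mul]
    rw [hA, hB, Matrix.one_apply, Matrix.one_apply, Matrix.one_apply]
    have hxy : x = y ↔ x 0 = y 0 ∧ x 1 = y 1 := by
      rw [funext_iff, Fin.forall_fin_two]
    by_cases h0 : x 0 = y 0 <;> by_cases h1 : x 1 = y 1 <;> simp [hxy, h0, h1]

/-- The tensor power `ρ^{⊗N}` of an operator on `ℂ^d`; the product basis is labelled by the
functions `Fin N → Fin d`. -/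
noncomputable def tensorPow {d : ℕ} (N : ℕ) (ρ : Matrix (Fin d) (Fin d) ℂ) :
    Matrix (Fin N → Fin d) (Fin N → Fin d) ℂ :=
  Matrix.of fun x y => ∏ i, ρ (x i) (y i)

/-- Density operators: positive semidefinite operators of trace one. -/
def IsDensity {d : ℕ} (ρ : Matrix (Fin d) (Fin d) ℂ) : Prop :=
  ρ.PosSemidef ∧ ρ.trace = 1

noncomputable instance unitaryMeasurableSpace (d : ℕ) : MeasurableSpace (unitaryGroup (Fin d) ℂ) := borel _

instance unitaryBorelSpace (d : ℕ) : BorelSpace (unitaryGroup (Fin d) ℂ) := ⟨rfl⟩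

instance unitaryCompactSpace (d : ℕ) : CompactSpace (unitaryGroup (Fin d) ℂ) := by
  refine isCompact_iff_compactSpace.mp ?_
  have hK : IsCompact (Set.univ.pi fun _ : Fin d => Set.univ.pi fun _ : Fin d =>
      Metric.closedBall (0 : ℂ) 1) :=
    isCompact_univ_pi fun _ => isCompact_univ_pi fun _ => isCompact_closedBall _ _
  refine hK.of_isClosed_subset ?_ ?_
  · have h : ((unitaryGroup (Fin d) ℂ : Submonoid (Matrix (Fin d) (Fin d) ℂ)) :
        Set (Matrix (Fin d) (Fin d) ℂ)) = {U | star U * U = 1} := by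
      ext U
      exact mem_unitaryGroup_iff'
    rw [h]
    exact isClosed_eq (by fun_prop) continuous_const
  · intro U hU i _ j _
    simpa using entry_norm_bound_of_unitary hU i j

/-- The normalized Haar measure on the unitary group of `ℂ^d`. -/
noncomputable def haarUnitary (d : ℕ) : Measure (unitaryGroup (Fin d) ℂ) :=
  Measure.haarMeasure ⊤

/-- The pure state `U |0⟩⟨0| U†`. For Haar random `U` this is a Haar random pure state. -/
noncomputable def pureState {d : ℕ} [NeZero d] (U : unitaryGroup (Fin d) ℂ) : Matrix (Fin d) (Fin d) ℂ :=
  (U : Matrix (Fin d) (Fin d) ℂ) * Matrix.single 0 0 1 * (U : Matrix (Fin d) (Fin d) ℂ)ᴴ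

/-- The average fidelity `∑_j ∫ tr(ρ^{⊗N} A_j) tr(ρ σ_j) dρ` over Haar random pure states `ρ` of
the `N`-copy measurement `A` with estimators `σ_j`. -/
noncomputable def averageFidelity {d N : ℕ} [NeZero d] {ι : Type*} [Fintype ι]
    (A : POVM (Fin N → Fin d) ι) (σ : ι → Matrix (Fin d) (Fin d) ℂ) : ℝ :=
  ∑ j, ∫ U, (tensorPow N (pureState U) * A.elem j).trace.re * (pureState U * σ j).trace.re
    ∂(haarUnitary d)

/-- The estimation fidelity `F(A)` of an `N`-copy measurement: the maximum of the average fidelity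
over all choices of the estimators, which are density operators on `ℂ^d`. -/
noncomputable def estimationFidelity {d N : ℕ} [NeZero d] {ι : Type*} [Fintype ι]
    (A : POVM (Fin N → Fin d) ι) : ℝ :=
  sSup {f | ∃ σ : ι → Matrix (Fin d) (Fin d) ℂ, (∀ j, IsDensity (σ j)) ∧ f = averageFidelity A σ}

/-- The constant
`F₂^iid = 2 (d² + d + 1 + (d - 1) √(d + 1)) / (d (d + 1) (d + 2))`. -/
noncomputable def F2iid (d : ℕ) : ℝ :=
  2 * ((d : ℝ) ^ 2 + d + 1 + ((d : ℝ) - 1) * Real.sqrt ((d : ℝ) + 1)) /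
    ((d : ℝ) * ((d : ℝ) + 1) * ((d : ℝ) + 2))

end QMeas

/-!
Three copies of a Haar random pure state are on average a multiple of the projector onto the
symmetric subspace: unitary invariance gives this on cubes of rank-one operators, and polarization
extends it to all products. For unit vectors `v`, `w` with `t = |⟨v|w⟩|`, the largest eigenvalue
`(1 + t) ^ 2` of `(|v⟩⟨v| + |w⟩⟨w|) ^ 2` shows that the best estimator for the outcome
`|v⟩⟨v| ⊗ |w⟩⟨w|` scores `2 (1 + t + t ^ 2)`. The fidelity of `A ⊗ B` is thus bounded through the
total weighted overlap `∑ w t` of the spectral refinements `F` of `A` and `G` of `B`.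

Here `∑ w = d ^ 2` and `∑ w t ^ 2 = d`, while `∑ w t ^ 4` exceeds its Haar value by the
Hilbert–Schmidt product of the deviations of `F` and `G` from `2`-designs. Bounding `t` by the
quadratic polynomial in `t ^ 2` that is tangent to it at the SIC value `t ^ 2 = 1 / (d + 1)` and
exact at `t = 1`, the total overlap is at most that of a SIC as soon as this product is nonnegative.
It is so for `F = G`, and equality forces `F` to be a `2`-design; then the product vanishes for `F`
and `G` as well, and equality forces every overlap to be `1 / √(d + 1)` or `1`. Lines with such
overlaps, without repetition by simplicity, form a SIC, and `G` cannot contain a line missing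
from `F`.
-/

namespace QMeas

open Matrix MeasureTheory
open scoped Kronecker ComplexOrder

section Ketbra

variable {n : Type*}

/-- The rank-one operator `|v⟩⟨v|`. -/
def ketbra (v : n → ℂ) : Matrix n n ℂ := vecMulVec v (star v)

lemma conjTranspose_ketbra (v : n → ℂ) : (ketbra v)ᴴ = ketbra v := by
  rw [ketbra, conjTranspose_vecMulVec, star_star]

lemma posSemidef_ketbra [Finite n] (v : n → ℂ) : (ketbra v).PosSemidef :=
  posSemidef_vecMulVec_self_star v

lemma ketbra_smul (c : ℂ) (v : n → ℂ) : ketbra (c • v) = (c * star c) • ketbra v := by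
  rw [ketbra, star_smul, smul_vecMulVec, vecMulVec_smul, smul_smul, ketbra]

variable [Fintype n]

lemma trace_ketbra (v : n → ℂ) : (ketbra v).trace = star v ⬝ᵥ v := by
  rw [ketbra, trace_vecMulVec, dotProduct_comm]

lemma ketbra_mulVec (v w : n → ℂ) : ketbra v *ᵥ w = (star v ⬝ᵥ w) • v := by
  ext i
  simp [ketbra, vecMulVec_mulVec, mul_comm]

lemma mul_ketbra_mul_conjTranspose (M : Matrix n n ℂ) (v : n → ℂ) :
    M * ketbra v * Mᴴ = ketbra (M *ᵥ v) := by
  rw [ketbra, ketbra, mul_vecMulVec, vecMulVec_mul, star_mulVec]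

lemma trace_mul_ketbra (M : Matrix n n ℂ) (v : n → ℂ) :
    (M * ketbra v).trace = star v ⬝ᵥ M *ᵥ v := by
  rw [ketbra, mul_vecMulVec, trace_vecMulVec, dotProduct_comm]

lemma ketbra_mul_mul_ketbra (v w : n → ℂ) (M : Matrix n n ℂ) :
    ketbra v * M * ketbra w = (star v ⬝ᵥ M *ᵥ w) • vecMulVec v (star w) := by
  rw [ketbra, ketbra, vecMulVec_mul, vecMulVec_mul_vecMulVec, ← dotProduct_mulVec,
    vecMulVec_smul]

lemma star_eigenvectorBasis_dotProduct [DecidableEq n] {M : Matrix n n ℂ}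
    (hM : M.IsHermitian) (i k : n) :
    star (hM.eigenvectorBasis i).ofLp ⬝ᵥ (hM.eigenvectorBasis k).ofLp = if i = k then 1 else 0 := by
  rw [← orthonormal_iff_ite.1 hM.eigenvectorBasis.orthonormal i k,
    EuclideanSpace.inner_eq_star_dotProduct, dotProduct_comm]

lemma eq_sum_smul_ketbra [DecidableEq n] {A : Matrix n n ℂ} (hA : A.IsHermitian) :
    A = ∑ i, hA.eigenvalues i • ketbra (hA.eigenvectorBasis i).ofLp := by
  conv_lhs => rw [hA.spectral_theorem, Unitary.conjStarAlgAut_apply]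
  ext p q
  simp [mul_apply, Matrix.sum_apply, ketbra, vecMulVec_apply, diagonal_apply, mul_assoc,
    mul_left_comm]

lemma linearMap_ext_ketbra {m E : Type*} [Finite m] [AddCommGroup E] [Module ℂ E]
    {f g : Matrix m m ℂ →ₗ[ℂ] E} (h : ∀ v, f (ketbra v) = g (ketbra v)) : f = g := by
  classical
  have := Fintype.ofFinite m
  have hherm {A : Matrix m m ℂ} (hA : A.IsHermitian) : f A = g A := by
    rw [eq_sum_smul_ketbra hA]
    simp only [← Complex.coe_smul, map_sum, map_smul, h]
  ext1 A
  rw [← realPart_add_I_smul_imaginaryPart A, map_add, map_add, map_smul, map_smul,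
    hherm (realPart A).2, hherm (imaginaryPart A).2]

end Ketbra

section SymTrace

variable {n : Type*} [Fintype n]

/-- The trace of `6 A ⊗ B ⊗ C` against the projector onto the symmetric subspace of three
copies, as a sum over the permutations of the copies. -/
def symTrace (A B C : Matrix n n ℂ) : ℂ :=
  A.trace * B.trace * C.trace + (A * B).trace * C.trace + (A * C).trace * B.trace +
    (B * C).trace * A.trace + (A * B * C).trace + (A * C * B).trace

lemma symTrace_rotate (A B C : Matrix n n ℂ) : symTrace B C A = symTrace A B C := by
  rw [symTrace, symTrace, trace_mul_comm B A, trace_mul_comm C A, trace_mul_cycle B C A,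
    trace_mul_cycle B A C, trace_mul_cycle C B A]
  ring

/-- `symTrace` as a linear functional of its last argument. -/
def symTraceLinear (A B : Matrix n n ℂ) : Matrix n n ℂ →ₗ[ℂ] ℂ where
  toFun C := symTrace A B C
  map_add' C D := by simp only [symTrace, mul_add, add_mul, trace_add]; ring
  map_smul' c C := by simp [symTrace]; ring

lemma symTrace_sum_smul {τ : Type*} (S : Finset τ) (c : τ → ℝ)
    (R : τ → Matrix n n ℂ) (A B : Matrix n n ℂ) :
    symTrace A B (∑ i ∈ S, c i • R i) = ∑ i ∈ S, (c i : ℂ) * symTrace A B (R i) := by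
  change symTraceLinear A B _ = _
  simp only [← Complex.coe_smul, map_sum, map_smul, smul_eq_mul]
  rfl

lemma re_symTrace_sum_smul_sum_smul {α β : Type*} (S : Finset α) (T : Finset β)
    (a : α → ℝ) (b : β → ℝ) (P : α → Matrix n n ℂ) (Q : β → Matrix n n ℂ) (C : Matrix n n ℂ) :
    (symTrace (∑ i ∈ S, a i • P i) (∑ k ∈ T, b k • Q k) C).re =
      ∑ i ∈ S, ∑ k ∈ T, a i * b k * (symTrace (P i) (Q k) C).re := by
  rw [← symTrace_rotate, symTrace_sum_smul, Complex.re_sum]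
  refine Finset.sum_congr rfl fun i _ => ?_
  rw [← symTrace_rotate, symTrace_sum_smul, Complex.re_ofReal_mul, Complex.re_sum, Finset.mul_sum]
  refine Finset.sum_congr rfl fun k _ => ?_
  rw [Complex.re_ofReal_mul, ← symTrace_rotate, mul_assoc]

lemma symTrace_ketbra_mul (v : n → ℂ) (A B C : Matrix n n ℂ) :
    symTrace (ketbra v * A) (ketbra v * B) (ketbra v * C) =
      6 * ((ketbra v * A).trace * (ketbra v * B).trace * (ketbra v * C).trace) := by
  have h2 (M N : Matrix n n ℂ) :
      (ketbra v * M * (ketbra v * N)).trace = (ketbra v * M).trace * (ketbra v * N).trace := by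
    rw [← mul_assoc, ketbra_mul_mul_ketbra, smul_mul_assoc, trace_smul, smul_eq_mul,
      trace_mul_comm (ketbra v) M, trace_mul_ketbra]
    rfl
  have h3 (L M N : Matrix n n ℂ) : (ketbra v * L * (ketbra v * M) * (ketbra v * N)).trace =
      (ketbra v * L).trace * (ketbra v * M).trace * (ketbra v * N).trace := by
    rw [mul_assoc (ketbra v * L), mul_assoc (ketbra v) M, h2, ← mul_assoc M,
      ← mul_assoc (ketbra v), ← mul_assoc (ketbra v), mul_assoc _ (ketbra v) N, h2]
    ring
  simp only [symTrace, h2, h3]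
  ring

lemma symTrace_one [DecidableEq n] :
    symTrace (1 : Matrix n n ℂ) 1 1 =
      Fintype.card n * (Fintype.card n + 1) * (Fintype.card n + 2) := by
  simp only [symTrace, mul_one, trace_one]
  ring

/-- Four times the difference between the mean of `f` over the fourth roots of unity and `f 0`.
For a polynomial in `z` and `conj z` of degree at most three in each, this keeps exactly the terms
`(z * conj z) ^ k` with `k ≠ 0`. -/
noncomputable def phaseDiff (f : ℂ → ℂ) : ℂ :=
  f 1 + f Complex.I + f (-1) + f (-Complex.I) - 4 * f 0

lemma integral_phaseDiff {X : Type*} [MeasurableSpace X] {μ : Measure X} {f : ℂ → X → ℂ}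
    (hf : ∀ z, Integrable (f z) μ) :
    ∫ x, phaseDiff (fun z => f z x) ∂μ = phaseDiff fun z => ∫ x, f z x ∂μ := by
  simp only [phaseDiff]
  rw [integral_sub (by fun_prop) (by fun_prop), integral_add (by fun_prop) (hf _),
    integral_add (by fun_prop) (hf _), integral_add (hf _) (hf _), integral_const_mul]

lemma phaseDiff_cube (s g p q : ℂ) :
    phaseDiff (fun z => (s + z * star z * g + z * p + star z * q) ^ 3) =
      4 * ((s + g) ^ 3 - s ^ 3 + 6 * (s + g) * (p * q)) := by
  simp only [phaseDiff, star_zero, star_one, star_neg, Complex.star_def, Complex.conj_I, neg_mul,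
    mul_neg, neg_neg, Complex.I_mul_I]
  ring_nf
  simp only [Complex.I_sq]
  ring

lemma trace_mul_ketbra_add_smul (H : Matrix n n ℂ) (a b : n → ℂ) (z : ℂ) :
    (H * ketbra (a + z • b)).trace = (H * ketbra a).trace + z * star z * (H * ketbra b).trace +
      z * (star a ⬝ᵥ H *ᵥ b) + star z * (star b ⬝ᵥ H *ᵥ a) := by
  simp only [trace_mul_ketbra, star_add, star_smul, mulVec_add, mulVec_smul, add_dotProduct,
    dotProduct_add, smul_dotProduct, dotProduct_smul, smul_eq_mul]
  ring

lemma symTrace_mul_ketbra (H : Matrix n n ℂ) (a b c : n → ℂ) :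
    symTrace (H * ketbra a) (H * ketbra b) (H * ketbra c) =
      phaseDiff (fun z => phaseDiff fun w => (H * ketbra (a + z • b + w • c)).trace ^ 3 -
        (H * ketbra (z • b + w • c)).trace ^ 3) / 96 := by
  -- Only the part of the cubes of bidegree `(1, 1)` in each of `a`, `b`, `c` survives: it is
  -- `6 = 3!` times the left side, and each `phaseDiff` contributes a factor `4`.
  have hsub (f g : ℂ → ℂ) : phaseDiff (fun z => f z - g z) = phaseDiff f - phaseDiff g := by
    simp only [phaseDiff]
    ring
  have hb (z : ℂ) : (H * ketbra (z • b)).trace = z * star z * (H * ketbra b).trace := by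
    rw [ketbra_smul, mul_smul_comm, trace_smul, smul_eq_mul]
  simp only [hsub, trace_mul_ketbra_add_smul _ _ c, phaseDiff_cube]
  simp only [hb, symTrace, trace_mul_ketbra, ← mul_assoc, ← mulVec_mulVec, ketbra_mulVec,
    mulVec_add, mulVec_smul, star_add, star_smul, add_dotProduct, dotProduct_add, smul_dotProduct,
    dotProduct_smul, smul_eq_mul]
  simp only [phaseDiff, star_zero, star_one, star_neg, Complex.star_def, Complex.conj_I, neg_mul,
    mul_neg, neg_neg, Complex.I_mul_I]
  ring_nf
  simp only [Complex.I_sq, Complex.I_pow_four]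
  ring

end SymTrace

section Haar

variable {d : ℕ}

instance isProbabilityMeasure_haarUnitary : IsProbabilityMeasure (haarUnitary d) :=
  ⟨Measure.haarMeasure_self⟩

instance isMulLeftInvariant_haarUnitary : (haarUnitary d).IsMulLeftInvariant :=
  Measure.isMulLeftInvariant_haarMeasure _

lemma integrable_haarUnitary {E : Type*} [NormedAddCommGroup E]
    {f : unitaryGroup (Fin d) ℂ → E} (hf : Continuous f) : Integrable f (haarUnitary d) :=
  hf.integrable_of_hasCompactSupport (.of_compactSpace f)

variable [NeZero d]

@[fun_prop]
lemma continuous_pureState : Continuous (pureState : unitaryGroup (Fin d) ℂ → _) := by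
  unfold pureState
  fun_prop

lemma pureState_eq_ketbra (U : unitaryGroup (Fin d) ℂ) : pureState U = ketbra (U.1.col 0) := by
  rw [pureState, ← mulVec_single_one, ← mul_ketbra_mul_conjTranspose]
  simp [ketbra, single_eq_single_vecMulVec_single]

lemma pureState_mul (V U : unitaryGroup (Fin d) ℂ) :
    pureState (V * U) = V.1 * pureState U * V.1ᴴ := by
  simp only [pureState, Submonoid.coe_mul, conjTranspose_mul, mul_assoc]

lemma exists_pureState_eq_ketbra {v : Fin d → ℂ} (hv : star v ⬝ᵥ v = 1) :
    ∃ V : unitaryGroup (Fin d) ℂ, pureState V = ketbra v := by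
  have hnorm : ‖WithLp.toLp 2 v‖ = 1 := by
    have hsq := inner_self_eq_norm_sq_to_K (𝕜 := ℂ) (WithLp.toLp 2 v)
    rw [EuclideanSpace.inner_eq_star_dotProduct, dotProduct_comm, hv] at hsq
    exact (pow_eq_one_iff_of_nonneg (norm_nonneg _) two_ne_zero).1
      (Complex.ofReal_injective (by rw [Complex.ofReal_pow]; exact hsq.symm))
  obtain ⟨b, hb⟩ := Orthonormal.exists_orthonormalBasis_extension_of_card_eq (𝕜 := ℂ)
    (v := fun _ : Fin d => WithLp.toLp 2 v) (s := {0}) finrank_euclideanSpace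
    ⟨fun _ => hnorm, fun i j hij => absurd (Subsingleton.elim i j) hij⟩
  refine ⟨⟨_, (EuclideanSpace.basisFun (Fin d) ℂ).toMatrix_orthonormalBasis_mem_unitary b⟩, ?_⟩
  rw [pureState_eq_ketbra]
  congr 1
  ext i
  simp [Module.Basis.toMatrix_apply, hb 0 rfl]

lemma exists_smul_unit_eq (v : Fin d → ℂ) :
    ∃ (r : ℂ) (x : Fin d → ℂ), star x ⬝ᵥ x = 1 ∧ v = r • x := by
  rcases eq_or_ne v 0 with rfl | hv
  · exact ⟨0, Pi.single 0 1, by simp, by simp⟩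
  · have hpos : 0 < star v ⬝ᵥ v := dotProduct_star_self_pos_iff.2 hv
    obtain ⟨r, hr, hrv⟩ := RCLike.pos_iff_exists_ofReal.1 hpos
    have hs : (√r : ℂ) ^ 2 = r := mod_cast Real.sq_sqrt hr.le
    have hs0 : (√r : ℂ) ≠ 0 := mod_cast (Real.sqrt_pos.2 hr).ne'
    refine ⟨√r, (√r : ℂ)⁻¹ • v, ?_, by rw [smul_inv_smul₀ hs0]⟩
    simp only [star_smul, smul_dotProduct, dotProduct_smul, ← hrv, smul_eq_mul, star_inv₀,
      Complex.star_def, Complex.conj_ofReal]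
    field_simp
    exact hs.symm

/-- The third moment of the overlap of a Haar random pure state with a fixed one. -/
noncomputable def haarCubeMoment (d : ℕ) [NeZero d] : ℂ :=
  ∫ U, (pureState U * pureState 1).trace ^ 3 ∂(haarUnitary d)

lemma integral_trace_pureState_mul_ketbra_cube (v : Fin d → ℂ) :
    ∫ U, (pureState U * ketbra v).trace ^ 3 ∂(haarUnitary d) =
      haarCubeMoment d * (ketbra v).trace ^ 3 := by
  obtain ⟨r, x, hx, rfl⟩ := exists_smul_unit_eq v
  obtain ⟨V, hV⟩ := exists_pureState_eq_ketbra hx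
  have hinv (U : unitaryGroup (Fin d) ℂ) :
      (pureState (V * U) * ketbra x).trace = (pureState U * pureState 1).trace := by
    have hVV : V.1ᴴ * V.1 = 1 := mem_unitaryGroup_iff'.1 V.2
    have hV1 : pureState V = V.1 * pureState 1 * V.1ᴴ := by rw [← pureState_mul, mul_one]
    have hconj : pureState (V * U) * ketbra x = V.1 * (pureState U * pureState 1) * V.1ᴴ := by
      rw [← hV, pureState_mul, hV1]
      simp only [mul_assoc]
      rw [← mul_assoc V.1ᴴ V.1, hVV, one_mul]
    rw [hconj, trace_mul_cycle, hVV, one_mul]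
  simp only [ketbra_smul, mul_smul_comm, trace_smul, smul_eq_mul, mul_pow, integral_const_mul]
  rw [← integral_mul_left_eq_self _ V]
  simp only [hinv, trace_ketbra, hx, haarCubeMoment]
  ring

lemma integral_trace_pureState_mul_ketbra (a b c : Fin d → ℂ) :
    ∫ U, (pureState U * ketbra a).trace * (pureState U * ketbra b).trace *
      (pureState U * ketbra c).trace ∂(haarUnitary d) =
      haarCubeMoment d / 6 * symTrace (ketbra a) (ketbra b) (ketbra c) := by
  have hrank (U : unitaryGroup (Fin d) ℂ) : (pureState U * ketbra a).trace *
      (pureState U * ketbra b).trace * (pureState U * ketbra c).trace =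
      symTrace (pureState U * ketbra a) (pureState U * ketbra b) (pureState U * ketbra c) / 6 := by
    rw [pureState_eq_ketbra, symTrace_ketbra_mul]
    ring
  have hone := symTrace_mul_ketbra 1 a b c
  simp only [one_mul] at hone
  simp only [hrank, symTrace_mul_ketbra (pureState _), hone, integral_div]
  rw [integral_phaseDiff fun z => integrable_haarUnitary (by unfold phaseDiff; fun_prop)]
  have hswap (z : ℂ) := integral_phaseDiff (μ := haarUnitary d) (f := fun w U =>
    (pureState U * ketbra (a + z • b + w • c)).trace ^ 3 -
      (pureState U * ketbra (z • b + w • c)).trace ^ 3)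
    fun w => integrable_haarUnitary (by fun_prop)
  have hsub (v w : Fin d → ℂ) : ∫ U, ((pureState U * ketbra v).trace ^ 3 -
      (pureState U * ketbra w).trace ^ 3) ∂(haarUnitary d) =
      haarCubeMoment d * ((ketbra v).trace ^ 3 - (ketbra w).trace ^ 3) := by
    rw [integral_sub (integrable_haarUnitary (by fun_prop)) (integrable_haarUnitary (by fun_prop)),
      integral_trace_pureState_mul_ketbra_cube, integral_trace_pureState_mul_ketbra_cube, mul_sub]
  simp only [hswap, hsub]
  simp only [phaseDiff]
  ring

/-- The third moment of a Haar random pure state, as a linear functional of the last observable. -/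
noncomputable def haarMoment (A B : Matrix (Fin d) (Fin d) ℂ) :
    Matrix (Fin d) (Fin d) ℂ →ₗ[ℂ] ℂ where
  toFun C := ∫ U, (pureState U * A).trace * (pureState U * B).trace * (pureState U * C).trace
    ∂(haarUnitary d)
  map_add' C D := by
    simp only [mul_add, trace_add]
    exact integral_add (integrable_haarUnitary (by fun_prop)) (integrable_haarUnitary (by fun_prop))
  map_smul' c C := by
    simp only [mul_smul_comm, trace_smul, smul_eq_mul, RingHom.id_apply, mul_left_comm _ c,
      integral_const_mul]

lemma haarMoment_rotate (A B C : Matrix (Fin d) (Fin d) ℂ) : haarMoment B C A = haarMoment A B C :=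
  integral_congr_ae (.of_forall fun U => by ring)

lemma haarMoment_eq_haarCubeMoment_mul_symTrace (A B C : Matrix (Fin d) (Fin d) ℂ) :
    haarMoment A B C = haarCubeMoment d / 6 * symTrace A B C := by
  have extend {A B : Matrix (Fin d) (Fin d) ℂ} (h : ∀ c, haarMoment A B (ketbra c) =
      haarCubeMoment d / 6 * symTrace A B (ketbra c)) (C : Matrix (Fin d) (Fin d) ℂ) :
      haarMoment A B C = haarCubeMoment d / 6 * symTrace A B C :=
    DFunLike.congr_fun
      (linearMap_ext_ketbra h : haarMoment A B = (haarCubeMoment d / 6) • symTraceLinear A B) C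
  refine extend (fun c => ?_) C
  rw [haarMoment_rotate, symTrace_rotate]
  refine extend (fun b => ?_) B
  rw [haarMoment_rotate, symTrace_rotate]
  exact extend (fun a => integral_trace_pureState_mul_ketbra _ _ a) A

lemma trace_pureState (U : unitaryGroup (Fin d) ℂ) : (pureState U).trace = 1 := by
  have hU : U.1ᴴ * U.1 = 1 := mem_unitaryGroup_iff'.1 U.2
  rw [pureState, trace_mul_comm, ← mul_assoc, hU, one_mul, trace_single_eq_same]

lemma integral_trace_pureState_mul (A B C : Matrix (Fin d) (Fin d) ℂ) :
    ∫ U, (pureState U * A).trace * (pureState U * B).trace * (pureState U * C).trace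
      ∂(haarUnitary d) = symTrace A B C / (d * (d + 1) * (d + 2)) := by
  have hone : haarMoment (d := d) 1 1 1 = 1 := by
    simp [haarMoment, trace_pureState]
  rw [haarMoment_eq_haarCubeMoment_mul_symTrace, symTrace_one, Fintype.card_fin] at hone
  have hd : (d * (d + 1) * (d + 2) : ℂ) ≠ 0 := right_ne_zero_of_mul (hone ▸ one_ne_zero)
  change haarMoment A B C = _
  rw [haarMoment_eq_haarCubeMoment_mul_symTrace, eq_div_iff hd]
  linear_combination symTrace A B C * hone

end Haar

section ProductMeasurement

variable {d : ℕ} {ι κ : Type*} [Fintype ι] [Fintype κ]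

lemma trace_tensorPow_mul_prod (A : POVM (Fin d) ι) (B : POVM (Fin d) κ)
    (ρ : Matrix (Fin d) (Fin d) ℂ) (p : ι × κ) :
    (tensorPow 2 ρ * (A.prod B).elem p).trace =
      (ρ * A.elem p.1).trace * (ρ * B.elem p.2).trace := by
  rw [← trace_kronecker, mul_kronecker_mul]
  simp only [trace, diag_apply, mul_apply]
  refine Fintype.sum_equiv (finTwoArrowEquiv (Fin d)) _ _ fun x => ?_
  refine Fintype.sum_equiv (finTwoArrowEquiv (Fin d)) _ _ fun y => ?_
  simp [tensorPow, POVM.prod, Fin.prod_univ_two, kroneckerMap_apply]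

lemma im_trace_mul_eq_zero {n : Type*} [Fintype n] {A B : Matrix n n ℂ} (hA : A.IsHermitian)
    (hB : B.IsHermitian) : (A * B).trace.im = 0 := by
  rw [← Complex.conj_eq_iff_im, ← Complex.star_def, ← trace_conjTranspose, conjTranspose_mul,
    hA.eq, hB.eq, trace_mul_comm]

variable [NeZero d]

lemma averageFidelity_prod (A : POVM (Fin d) ι) (B : POVM (Fin d) κ)
    (σ : ι × κ → Matrix (Fin d) (Fin d) ℂ) :
    averageFidelity (A.prod B) σ =
      (∑ p, (symTrace (A.elem p.1) (B.elem p.2) (σ p)).re) / (d * (d + 1) * (d + 2)) := by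
  rw [averageFidelity, Finset.sum_div]
  refine Finset.sum_congr rfl fun p _ => ?_
  have hreal {M : Matrix (Fin d) (Fin d) ℂ} (hM : M.IsHermitian) (U : unitaryGroup (Fin d) ℂ) :
      (pureState U * M).trace.im = 0 :=
    im_trace_mul_eq_zero (pureState_eq_ketbra U ▸ (posSemidef_ketbra _).isHermitian) hM
  have hmoment := congrArg Complex.re
    (integral_trace_pureState_mul (A.elem p.1) (B.elem p.2) (σ p))
  rw [← RCLike.re_eq_complex_re, ← integral_re (integrable_haarUnitary (by fun_prop))] at hmoment
  have hden : (d * (d + 1) * (d + 2) : ℂ) = ((d * (d + 1) * (d + 2) : ℝ) : ℂ) := by push_cast; rfl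
  rw [hden, RCLike.re_eq_complex_re, Complex.div_ofReal_re] at hmoment
  simpa [trace_tensorPow_mul_prod, Complex.mul_re, hreal (A.posSemidef _).isHermitian,
    hreal (B.posSemidef _).isHermitian] using hmoment

end ProductMeasurement

section RankOne

variable {n : Type*} [Fintype n]

/-- The overlap `|⟨v|w⟩|`. -/
noncomputable def overlap (v w : n → ℂ) : ℝ := ‖star v ⬝ᵥ w‖

lemma overlap_nonneg (v w : n → ℂ) : 0 ≤ overlap v w := norm_nonneg _

lemma overlap_comm (v w : n → ℂ) : overlap v w = overlap w v := by
  rw [overlap, overlap, ← norm_star, star_dotProduct, star_star, dotProduct_comm]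

lemma overlap_self {v : n → ℂ} (hv : star v ⬝ᵥ v = 1) : overlap v v = 1 := by
  rw [overlap, hv, norm_one]

lemma trace_ketbra_mul_ketbra (v w : n → ℂ) :
    (ketbra v * ketbra w).trace = (overlap v w ^ 2 : ℝ) := by
  have hconj : star w ⬝ᵥ v = star (star v ⬝ᵥ w) := star_dotProduct w v
  rw [trace_mul_ketbra, ketbra_mulVec, dotProduct_smul, smul_eq_mul, hconj, Complex.star_def,
    Complex.mul_conj', Complex.ofReal_pow, overlap]

lemma overlap_congr {v v' w w' : n → ℂ} (hv : ketbra v = ketbra v')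
    (hw : ketbra w = ketbra w') : overlap v w = overlap v' w' := by
  have h := trace_ketbra_mul_ketbra v w
  rw [hv, hw, trace_ketbra_mul_ketbra, Complex.ofReal_inj] at h
  exact ((sq_eq_sq₀ (overlap_nonneg _ _) (overlap_nonneg _ _)).1 h).symm

lemma ketbra_mul_self {v : n → ℂ} (hv : star v ⬝ᵥ v = 1) : ketbra v * ketbra v = ketbra v := by
  rw [ketbra, vecMulVec_mul_vecMulVec, hv, one_smul]

lemma trace_ketbra_sub_ketbra_sq {v w : n → ℂ} (hv : star v ⬝ᵥ v = 1) (hw : star w ⬝ᵥ w = 1) :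
    ((ketbra v - ketbra w)ᴴ * (ketbra v - ketbra w)).trace = (2 * (1 - overlap v w ^ 2) : ℝ) := by
  rw [conjTranspose_sub, conjTranspose_ketbra, conjTranspose_ketbra, mul_sub, sub_mul, sub_mul,
    trace_sub, trace_sub, trace_sub, trace_mul_comm (ketbra w) (ketbra v), ketbra_mul_self hv,
    ketbra_mul_self hw, trace_ketbra_mul_ketbra, trace_ketbra, trace_ketbra, hv, hw]
  push_cast
  ring

lemma overlap_le_one {v w : n → ℂ} (hv : star v ⬝ᵥ v = 1) (hw : star w ⬝ᵥ w = 1) :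
    overlap v w ≤ 1 := by
  have hpos := (posSemidef_conjTranspose_mul_self (ketbra v - ketbra w)).trace_nonneg
  rw [trace_ketbra_sub_ketbra_sq hv hw, Complex.zero_le_real] at hpos
  exact (sq_le_one_iff₀ (overlap_nonneg v w)).1 (by linarith)

lemma overlap_eq_one_iff {v w : n → ℂ} (hv : star v ⬝ᵥ v = 1) (hw : star w ⬝ᵥ w = 1) :
    overlap v w = 1 ↔ ketbra v = ketbra w := by
  rw [← sub_eq_zero (a := ketbra v), ← trace_conjTranspose_mul_self_eq_zero_iff,
    trace_ketbra_sub_ketbra_sq hv hw, Complex.ofReal_eq_zero, mul_eq_zero_iff_left two_ne_zero,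
    sub_eq_zero, eq_comm (a := (1 : ℝ)), pow_eq_one_iff_of_nonneg (overlap_nonneg v w) two_ne_zero]

lemma exists_ketbra_eq_dotProduct_eq_overlap (v w : n → ℂ) :
    ∃ x, ketbra x = ketbra w ∧ star v ⬝ᵥ x = overlap v w := by
  obtain ⟨c, hc, hcw⟩ := Complex.exists_norm_eq_mul_self (star v ⬝ᵥ w)
  refine ⟨c • w, ?_, by rw [dotProduct_smul, smul_eq_mul, ← hcw, overlap]⟩
  rw [ketbra_smul, Complex.star_def, Complex.mul_conj', hc, Complex.ofReal_one, one_pow, one_smul]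

lemma trace_mul_nonneg_of_posSemidef {A B : Matrix n n ℂ} (hA : A.PosSemidef)
    (hB : B.PosSemidef) : 0 ≤ (A * B).trace := by
  classical
  rw [eq_sum_smul_ketbra hA.isHermitian, Finset.sum_mul, trace_sum]
  refine Finset.sum_nonneg fun i _ => ?_
  rw [smul_mul_assoc, trace_smul, trace_mul_comm, trace_mul_ketbra]
  exact smul_nonneg (hA.eigenvalues_nonneg i) (hB.dotProduct_mulVec_nonneg _)

variable {v w : n → ℂ} {t : ℝ}

lemma star_dotProduct_comm_of_real (ht : star v ⬝ᵥ w = t) : star w ⬝ᵥ v = t := by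
  rw [star_dotProduct, ht, Complex.star_def, Complex.conj_ofReal]

lemma symTrace_ketbra_ketbra (hv : star v ⬝ᵥ v = 1) (hw : star w ⬝ᵥ w = 1)
    (σ : Matrix n n ℂ) : symTrace (ketbra v) (ketbra w) σ = (1 + overlap v w ^ 2 : ℝ) * σ.trace +
      ((ketbra v + ketbra w) * (ketbra v + ketbra w) * σ).trace := by
  rw [symTrace, trace_ketbra_mul_ketbra, trace_ketbra, trace_ketbra, hv, hw,
    trace_mul_cycle (ketbra v) σ]
  simp only [mul_add, add_mul, trace_add, ketbra_mul_self hv, ketbra_mul_self hw]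
  push_cast
  ring

lemma ketbra_add_mul_self (hv : star v ⬝ᵥ v = 1) (hw : star w ⬝ᵥ w = 1) (ht : star v ⬝ᵥ w = t) :
    (ketbra v + ketbra w) * (ketbra v + ketbra w) =
      (1 + t) • (ketbra v + ketbra w) - t • ketbra (v - w) := by
  have ht' : star w ⬝ᵥ v = t := star_dotProduct_comm_of_real ht
  have hvw : ketbra v * ketbra w = t • vecMulVec v (star w) := by
    rw [ketbra, ketbra, vecMulVec_mul_vecMulVec, ht, vecMulVec_smul, Complex.coe_smul]
  have hwv : ketbra w * ketbra v = t • vecMulVec w (star v) := by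
    rw [ketbra, ketbra, vecMulVec_mul_vecMulVec, ht', vecMulVec_smul, Complex.coe_smul]
  simp only [mul_add, add_mul, ketbra_mul_self hv, ketbra_mul_self hw, hvw, hwv]
  simp only [ketbra, star_sub, vecMulVec_sub, sub_vecMulVec]
  module

lemma posSemidef_sq_sub_ketbra_add_mul_self [DecidableEq n] (hv : star v ⬝ᵥ v = 1)
    (hw : star w ⬝ᵥ w = 1) (ht : star v ⬝ᵥ w = t) (ht0 : 0 ≤ t) :
    ((1 + t) ^ 2 • (1 : Matrix n n ℂ) -
      (ketbra v + ketbra w) * (ketbra v + ketbra w)).PosSemidef := by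
  set M := ketbra v + ketbra w with hM
  have hherm : ((1 + t) • (1 : Matrix n n ℂ) - M)ᴴ = (1 + t) • (1 : Matrix n n ℂ) - M := by
    simp [hM, conjTranspose_ketbra]
  have hsplit : (1 + t) ^ 2 • (1 : Matrix n n ℂ) - M * M =
      ((1 + t) • (1 : Matrix n n ℂ) - M)ᴴ * ((1 + t) • (1 : Matrix n n ℂ) - M) +
        (2 * t) • ketbra (v - w) := by
    rw [hherm]
    simp only [mul_sub, sub_mul, smul_mul_assoc, mul_smul_comm, one_mul, mul_one]
    rw [ketbra_add_mul_self hv hw ht, ← hM]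
    module
  rw [hsplit]
  exact (posSemidef_conjTranspose_mul_self _).add ((posSemidef_ketbra _).smul (by positivity))

lemma re_symTrace_ketbra_ketbra_le (hv : star v ⬝ᵥ v = 1) (hw : star w ⬝ᵥ w = 1)
    {σ : Matrix n n ℂ} (hσ : σ.PosSemidef) (hσ1 : σ.trace = 1) :
    (symTrace (ketbra v) (ketbra w) σ).re ≤ 2 * (1 + overlap v w + overlap v w ^ 2) := by
  classical
  obtain ⟨x, hxw, hx⟩ := exists_ketbra_eq_dotProduct_eq_overlap v w
  have hx1 : star x ⬝ᵥ x = 1 := by rw [← trace_ketbra, hxw, trace_ketbra, hw]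
  have hpos := (Complex.le_def.1 (trace_mul_nonneg_of_posSemidef
    (posSemidef_sq_sub_ketbra_add_mul_self hv hx1 hx (overlap_nonneg v w)) hσ)).1
  rw [sub_mul, smul_mul_assoc, one_mul, trace_sub, trace_smul, hσ1, hxw] at hpos
  simp only [Complex.zero_re, Complex.sub_re, Complex.smul_re, Complex.one_re,
    smul_eq_mul, mul_one] at hpos
  rw [symTrace_ketbra_ketbra hv hw, hσ1, mul_one, Complex.add_re, Complex.ofReal_re]
  linarith

lemma ketbra_add_mul_ketbra_add (hv : star v ⬝ᵥ v = 1) (hw : star w ⬝ᵥ w = 1)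
    (ht : star v ⬝ᵥ w = t) :
    (ketbra v + ketbra w) * ketbra (v + w) = (1 + t) • ketbra (v + w) := by
  have ht' : star w ⬝ᵥ v = t := star_dotProduct_comm_of_real ht
  have heigen : (ketbra v + ketbra w) *ᵥ (v + w) = (1 + t) • (v + w) := by
    simp only [add_mulVec, ketbra_mulVec, dotProduct_add, hv, hw, ht, ht']
    module
  rw [ketbra.eq_def (v + w), mul_vecMulVec, heigen, smul_vecMulVec]

lemma exists_re_symTrace_ketbra_ketbra_eq (hv : star v ⬝ᵥ v = 1) (hw : star w ⬝ᵥ w = 1) :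
    ∃ σ : Matrix n n ℂ, σ.PosSemidef ∧ σ.trace = 1 ∧
      (symTrace (ketbra v) (ketbra w) σ).re = 2 * (1 + overlap v w + overlap v w ^ 2) := by
  obtain ⟨x, hxw, hx⟩ := exists_ketbra_eq_dotProduct_eq_overlap v w
  have hx1 : star x ⬝ᵥ x = 1 := by rw [← trace_ketbra, hxw, trace_ketbra, hw]
  have ht0 := overlap_nonneg v w
  have htrace : (ketbra (v + x)).trace = (2 * (1 + overlap v w) : ℝ) := by
    rw [trace_ketbra, star_add, add_dotProduct, dotProduct_add, dotProduct_add, hv, hx1, hx,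
      star_dotProduct_comm_of_real hx]
    push_cast
    ring
  set σ := (2 * (1 + overlap v w))⁻¹ • ketbra (v + x)
  have hσ1 : σ.trace = 1 := by
    rw [trace_smul, htrace, Complex.real_smul, ← Complex.ofReal_mul,
      inv_mul_cancel₀ (by positivity), Complex.ofReal_one]
  have heigen : (ketbra v + ketbra w) * σ = (1 + overlap v w) • σ := by
    rw [← hxw, mul_smul_comm, ketbra_add_mul_ketbra_add hv hx1 hx, smul_comm]
  refine ⟨σ, (posSemidef_ketbra _).smul (by positivity), hσ1, ?_⟩
  rw [symTrace_ketbra_ketbra hv hw, mul_assoc, heigen, mul_smul_comm, heigen, smul_smul,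
    hσ1, trace_smul, hσ1, mul_one, Complex.add_re, Complex.ofReal_re, Complex.smul_re,
    Complex.one_re, smul_eq_mul]
  ring

end RankOne

section Swap

variable {n : Type*} [DecidableEq n]

/-- The operator on `ℂ^n ⊗ ℂ^n` that exchanges the two factors. -/
def swapMatrix (n : Type*) [DecidableEq n] : Matrix (n × n) (n × n) ℂ :=
  Equiv.Perm.permMatrix ℂ (Equiv.prodComm n n)

lemma conjTranspose_swapMatrix : (swapMatrix n)ᴴ = swapMatrix n := by
  rw [swapMatrix, conjTranspose_permMatrix]
  rfl

variable [Fintype n]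

lemma swapMatrix_mul_self : swapMatrix n * swapMatrix n = 1 := by
  rw [swapMatrix, ← permMatrix_mul, ← permMatrix_one]
  rfl

lemma trace_kronecker_mul_swapMatrix (A B : Matrix n n ℂ) :
    ((A ⊗ₖ B) * swapMatrix n).trace = (A * B).trace := by
  simp only [swapMatrix, trace, diag_apply, mul_apply, Fintype.sum_prod_type,
    Equiv.Perm.permMatrix, PEquiv.toMatrix_apply]
  simp [Prod.ext_iff, ite_and]

lemma trace_one_add_swapMatrix_mul_self :
    ((1 + swapMatrix n) * (1 + swapMatrix n)).trace =
      2 * Fintype.card n * (Fintype.card n + 1) := by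
  have hswap : (swapMatrix n).trace = Fintype.card n := by
    rw [← one_mul (swapMatrix n), ← one_kronecker_one, trace_kronecker_mul_swapMatrix, one_mul,
      trace_one]
  rw [mul_add, add_mul, add_mul, swapMatrix_mul_self, mul_one, mul_one, one_mul]
  simp only [trace_add, hswap, trace_one, Fintype.card_prod]
  push_cast
  ring

end Swap

/-- A decomposition of the identity of `ℂ^d` into positive multiples of projectors onto lines, each
spanned by a unit vector. -/
structure WeightedFrame (d : ℕ) (α : Type*) [Fintype α] where
  /-- the weights -/
  wt : α → ℝ
  /-- the unit vectors -/
  vec : α → Fin d → ℂ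
  wt_pos : ∀ a, 0 < wt a
  star_dotProduct_vec : ∀ a, star (vec a) ⬝ᵥ vec a = 1
  sum_eq_one : ∑ a, wt a • ketbra (vec a) = 1

namespace WeightedFrame

variable {d : ℕ} {α β : Type*} [Fintype α] [Fintype β] (F : WeightedFrame d α)
  (G : WeightedFrame d β)

lemma sum_wt : ∑ a, F.wt a = d := by
  have h := congrArg trace F.sum_eq_one
  simp only [trace_sum, trace_smul, trace_ketbra, F.star_dotProduct_vec, trace_one,
    Fintype.card_fin, Complex.real_smul, mul_one] at h
  exact_mod_cast h

lemma sum_wt_mul_overlap_sq {w : Fin d → ℂ} (hw : star w ⬝ᵥ w = 1) :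
    ∑ a, F.wt a * overlap (F.vec a) w ^ 2 = 1 := by
  have h := congrArg (fun M => (M * ketbra w).trace) F.sum_eq_one
  simp only [Finset.sum_mul, trace_sum, smul_mul_assoc, trace_smul, trace_ketbra_mul_ketbra,
    one_mul, trace_ketbra, hw, Complex.real_smul] at h
  exact_mod_cast h

lemma sum_wt_mul_wt : ∑ a, ∑ b, F.wt a * G.wt b = (d : ℝ) ^ 2 := by
  rw [← Finset.sum_mul_sum, sum_wt, sum_wt, sq]

lemma sum_wt_mul_wt_mul_overlap_sq :
    ∑ a, ∑ b, F.wt a * G.wt b * overlap (F.vec a) (G.vec b) ^ 2 = d := by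
  rw [← F.sum_wt]
  refine Finset.sum_congr rfl fun a _ => ?_
  simp only [overlap_comm (F.vec a), mul_assoc, ← Finset.mul_sum,
    G.sum_wt_mul_overlap_sq (F.star_dotProduct_vec a), mul_one]

/-- The second moment `∑ w (P ⊗ P)` of the projectors of the frame. -/
noncomputable def secondMoment : Matrix (Fin d × Fin d) (Fin d × Fin d) ℂ :=
  ∑ a, F.wt a • (ketbra (F.vec a) ⊗ₖ ketbra (F.vec a))

lemma conjTranspose_secondMoment : F.secondMomentᴴ = F.secondMoment := by
  simp only [secondMoment, conjTranspose_sum, conjTranspose_smul, conjTranspose_kronecker,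
    conjTranspose_ketbra, star_trivial]

lemma trace_secondMoment_mul_secondMoment : (F.secondMoment * G.secondMoment).trace =
    (∑ a, ∑ b, F.wt a * G.wt b * overlap (F.vec a) (G.vec b) ^ 4 : ℝ) := by
  simp only [secondMoment, Finset.sum_mul_sum, trace_sum, smul_mul_assoc, mul_smul_comm,
    ← mul_kronecker_mul, trace_smul, trace_kronecker, trace_ketbra_mul_ketbra, Complex.real_smul,
    Complex.ofReal_sum]
  refine Finset.sum_congr rfl fun a _ => Finset.sum_congr rfl fun b _ => ?_
  push_cast
  ring

lemma trace_secondMoment_mul_one_add_swapMatrix :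
    (F.secondMoment * (1 + swapMatrix (Fin d))).trace = 2 * d := by
  have hproj (a : α) :
      ((ketbra (F.vec a) ⊗ₖ ketbra (F.vec a)) * (1 + swapMatrix (Fin d))).trace = 2 := by
    rw [mul_add, mul_one, trace_add, trace_kronecker, trace_kronecker_mul_swapMatrix,
      ketbra_mul_self (F.star_dotProduct_vec a), trace_ketbra, F.star_dotProduct_vec]
    norm_num
  simp only [secondMoment, Finset.sum_mul, trace_sum, smul_mul_assoc, trace_smul, hproj]
  rw [← Finset.sum_smul, F.sum_wt, Complex.real_smul, Complex.ofReal_natCast, mul_comm]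

/-- The deviation of the second moment of the frame from that of the Haar measure; it vanishes
exactly when the frame is a complex projective `2`-design. -/
noncomputable def designDefect : Matrix (Fin d × Fin d) (Fin d × Fin d) ℂ :=
  F.secondMoment - (1 / (d + 1) : ℝ) • (1 + swapMatrix (Fin d))

lemma trace_designDefect_mul_designDefect : (F.designDefectᴴ * G.designDefect).trace =
    (∑ a, ∑ b, F.wt a * G.wt b * overlap (F.vec a) (G.vec b) ^ 4 - 2 * d / (d + 1) : ℝ) := by
  have hherm : F.designDefectᴴ = F.designDefect := by
    rw [designDefect, conjTranspose_sub, conjTranspose_secondMoment, conjTranspose_smul,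
      conjTranspose_add, conjTranspose_one, conjTranspose_swapMatrix, star_trivial]
  have hd : (d + 1 : ℂ) ≠ 0 := Nat.cast_add_one_ne_zero d
  rw [hherm, designDefect, designDefect, sub_mul, mul_sub, mul_sub]
  simp only [smul_mul_assoc, mul_smul_comm, trace_sub, trace_smul]
  rw [trace_mul_comm (1 + _) G.secondMoment, trace_secondMoment_mul_secondMoment,
    trace_secondMoment_mul_one_add_swapMatrix, trace_secondMoment_mul_one_add_swapMatrix,
    trace_one_add_swapMatrix_mul_self, Fintype.card_fin]
  simp only [Complex.real_smul]
  push_cast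
  field_simp
  ring

/-- The total weighted overlap of two frames. -/
noncomputable def totalOverlap : ℝ :=
  ∑ a, ∑ b, F.wt a * G.wt b * overlap (F.vec a) (G.vec b)

end WeightedFrame

/-- The overlap `1 / √(d + 1)` of distinct elements of a SIC. -/
noncomputable def sicOverlap (d : ℕ) : ℝ := 1 / √(d + 1)

lemma sicOverlap_pos (d : ℕ) : 0 < sicOverlap d := by
  unfold sicOverlap
  positivity

lemma sicOverlap_sq (d : ℕ) : sicOverlap d ^ 2 = 1 / (d + 1) := by
  rw [sicOverlap, div_pow, Real.sq_sqrt (by positivity), one_pow]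

lemma sicOverlap_ne_one (d : ℕ) [NeZero d] : sicOverlap d ≠ 1 := by
  intro h
  have hd := NeZero.ne (d : ℝ)
  have hsq := sicOverlap_sq d
  rw [h, one_pow, eq_div_iff (by positivity), one_mul, add_eq_right] at hsq
  exact hd hsq

/-- The total overlap of a SIC with itself. -/
noncomputable def sicTotalOverlap (d : ℕ) : ℝ := 1 + (d - 1) * √(d + 1)

lemma F2iid_eq (d : ℕ) :
    F2iid d = 2 * (d ^ 2 + d + sicTotalOverlap d) / (d * (d + 1) * (d + 2)) := by
  rw [F2iid, sicTotalOverlap]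
  ring

lemma one_add_sicOverlap_mul_sicTotalOverlap (d : ℕ) :
    (1 + sicOverlap d) * sicTotalOverlap d = d + sicOverlap d * d ^ 2 := by
  have hd : (d : ℝ) = √(d + 1) ^ 2 - 1 := by rw [Real.sq_sqrt (by positivity), add_sub_cancel_right]
  rw [sicTotalOverlap, sicOverlap]
  set q := √((d : ℝ) + 1)
  have hq0 : 0 < q := Real.sqrt_pos.2 (by positivity)
  rw [hd]
  field_simp
  ring

/-- A positive multiple of `p (t ^ 2) - t`, where `p` is the quadratic polynomial whose graph is
tangent to that of the square root at `sicOverlap d ^ 2` and meets it at `1`. -/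
noncomputable def overlapGap (d : ℕ) (t : ℝ) : ℝ :=
  (t - sicOverlap d) ^ 2 * (1 - t) * (t + 1 + 2 * sicOverlap d)

lemma overlapGap_nonneg (d : ℕ) {t : ℝ} (h0 : 0 ≤ t) (h1 : t ≤ 1) : 0 ≤ overlapGap d t := by
  have hs := sicOverlap_pos d
  have : 0 ≤ 1 - t := sub_nonneg.2 h1
  unfold overlapGap
  positivity

lemma overlapGap_eq_zero_iff {d : ℕ} {t : ℝ} (h0 : 0 ≤ t) :
    overlapGap d t = 0 ↔ t = sicOverlap d ∨ t = 1 := by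
  have hs : t + 1 + 2 * sicOverlap d ≠ 0 := by linarith [sicOverlap_pos d]
  rw [overlapGap, mul_eq_zero_iff_right hs, mul_eq_zero, sq_eq_zero_iff, sub_eq_zero, sub_eq_zero,
    eq_comm (a := 1)]

namespace WeightedFrame

variable {d : ℕ} {α β : Type*} [Fintype α] [Fintype β] (F : WeightedFrame d α)
  (G : WeightedFrame d β)

lemma totalOverlap_add_trace_add_sum_overlapGap :
    2 * sicOverlap d * (1 + sicOverlap d) ^ 2 * F.totalOverlap G +
      (F.designDefectᴴ * G.designDefect).trace.re +
      ∑ a, ∑ b, F.wt a * G.wt b * overlapGap d (overlap (F.vec a) (G.vec b)) =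
    2 * sicOverlap d * (1 + sicOverlap d) ^ 2 * sicTotalOverlap d := by
  rw [trace_designDefect_mul_designDefect, Complex.ofReal_re]
  have h0 := F.sum_wt_mul_wt G
  have h2 := F.sum_wt_mul_wt_mul_overlap_sq G
  have hT := one_add_sicOverlap_mul_sicTotalOverlap d
  have hs := sicOverlap_sq d
  set s := sicOverlap d
  have hexpand (a : α) (b : β) : F.wt a * G.wt b * overlapGap d (overlap (F.vec a) (G.vec b)) =
      s ^ 2 * (1 + 2 * s) * (F.wt a * G.wt b) +
      (1 + 2 * s + 3 * s ^ 2) * (F.wt a * G.wt b * overlap (F.vec a) (G.vec b) ^ 2) -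
      F.wt a * G.wt b * overlap (F.vec a) (G.vec b) ^ 4 -
      2 * s * (1 + s) ^ 2 * (F.wt a * G.wt b * overlap (F.vec a) (G.vec b)) := by
    rw [overlapGap]
    ring
  simp only [hexpand, Finset.sum_sub_distrib, Finset.sum_add_distrib, ← Finset.mul_sum] at h0 h2 ⊢
  have hdiv : 2 * d / (d + 1 : ℝ) = 2 * d * s ^ 2 := by rw [hs, mul_one_div]
  rw [eq_div_iff (by positivity)] at hs
  rw [h0, h2, hdiv, totalOverlap]
  linear_combination (-2 * s * (1 + s)) * hT - d * hs

lemma overlap_vec_le_one (a : α) (b : β) : overlap (F.vec a) (G.vec b) ≤ 1 :=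
  overlap_le_one (F.star_dotProduct_vec a) (G.star_dotProduct_vec b)

lemma wt_mul_wt_mul_overlapGap_nonneg (a : α) (b : β) :
    0 ≤ F.wt a * G.wt b * overlapGap d (overlap (F.vec a) (G.vec b)) :=
  mul_nonneg (mul_pos (F.wt_pos a) (G.wt_pos b)).le
    (overlapGap_nonneg d (overlap_nonneg _ _) (F.overlap_vec_le_one G a b))

lemma designDefect_eq_zero_of_sicTotalOverlap_le (h : sicTotalOverlap d ≤ F.totalOverlap F) :
    F.designDefect = 0 := by
  have hid := F.totalOverlap_add_trace_add_sum_overlapGap F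
  have hgap := Finset.sum_nonneg fun a (_ : a ∈ Finset.univ) => Finset.sum_nonneg
    fun b (_ : b ∈ Finset.univ) => F.wt_mul_wt_mul_overlapGap_nonneg F a b
  have hpos := (posSemidef_conjTranspose_mul_self F.designDefect).trace_nonneg
  obtain ⟨hre, him⟩ := Complex.le_def.1 hpos
  have hs := sicOverlap_pos d
  have hT : 2 * sicOverlap d * (1 + sicOverlap d) ^ 2 * sicTotalOverlap d ≤
    2 * sicOverlap d * (1 + sicOverlap d) ^ 2 * F.totalOverlap F := by gcongr
  refine trace_conjTranspose_mul_self_eq_zero_iff.1 (Complex.ext (le_antisymm ?_ hre) him.symm)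
  rw [Complex.zero_re]
  linarith

/-- The overlaps of two frames are those of a SIC with itself: those of coinciding elements, and
those of distinct elements. -/
def HasSICOverlaps : Prop :=
  ∀ a b, overlap (F.vec a) (G.vec b) = sicOverlap d ∨ overlap (F.vec a) (G.vec b) = 1

variable {F G}

lemma hasSICOverlaps_of_sicTotalOverlap_le (hF : F.designDefect = 0)
    (h : sicTotalOverlap d ≤ F.totalOverlap G) : F.HasSICOverlaps G := by
  intro a b
  have hid := F.totalOverlap_add_trace_add_sum_overlapGap G
  rw [hF, conjTranspose_zero, zero_mul, trace_zero, Complex.zero_re, add_zero] at hid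
  have hs := sicOverlap_pos d
  have hT : 2 * sicOverlap d * (1 + sicOverlap d) ^ 2 * sicTotalOverlap d ≤
    2 * sicOverlap d * (1 + sicOverlap d) ^ 2 * F.totalOverlap G := by gcongr
  have hterm (p : α × β) (_ : p ∈ Finset.univ) := F.wt_mul_wt_mul_overlapGap_nonneg G p.1 p.2
  have hsum := Finset.sum_nonneg hterm
  rw [← Fintype.sum_prod_type'] at hid
  have hzero := (Finset.sum_eq_zero_iff_of_nonneg hterm).1 (le_antisymm (by linarith) hsum) (a, b)
    (Finset.mem_univ _)
  exact (overlapGap_eq_zero_iff (overlap_nonneg _ _)).1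
    ((mul_eq_zero.1 hzero).resolve_left (mul_pos (F.wt_pos a) (G.wt_pos b)).ne')

lemma HasSICOverlaps.totalOverlap_eq (h : F.HasSICOverlaps G) :
    F.totalOverlap G = sicTotalOverlap d := by
  have hs := sicOverlap_pos d
  have hquad (a : α) (b : β) : (1 + sicOverlap d) * overlap (F.vec a) (G.vec b) =
      overlap (F.vec a) (G.vec b) ^ 2 + sicOverlap d := by
    rcases h a b with h | h <;> rw [h] <;> ring
  refine mul_left_cancel₀ (by positivity : 1 + sicOverlap d ≠ 0) ?_
  rw [one_add_sicOverlap_mul_sicTotalOverlap, ← F.sum_wt_mul_wt G,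
    ← F.sum_wt_mul_wt_mul_overlap_sq G, totalOverlap]
  simp only [Finset.mul_sum, ← Finset.sum_add_distrib]
  refine Finset.sum_congr rfl fun a _ => Finset.sum_congr rfl fun b _ => ?_
  linear_combination F.wt a * G.wt b * hquad a b

end WeightedFrame

lemma exists_isDensity (d : ℕ) [NeZero d] : ∃ σ : Matrix (Fin d) (Fin d) ℂ, IsDensity σ :=
  ⟨ketbra (Pi.single 0 1), posSemidef_ketbra _, by simp [trace_ketbra]⟩

namespace WeightedFrame

variable {d : ℕ} {α β ι κ : Type*} [Fintype α] [Fintype β] [Fintype ι] [Fintype κ]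

open Classical in
/-- The elements of the POVM `A` are the partial sums of the frame over the fibres of `r`: the
measurement `A` is a coarse-graining of the rank-one measurement defined by the frame. -/
def Refines (F : WeightedFrame d α) (A : POVM (Fin d) ι) (r : α → ι) : Prop :=
  ∀ j, A.elem j = ∑ a with r a = j, F.wt a • ketbra (F.vec a)

lemma sum_wt_mul_wt_mul_fidelity (F : WeightedFrame d α) (G : WeightedFrame d β) :
    ∑ a, ∑ b, F.wt a * G.wt b *
      (2 * (1 + overlap (F.vec a) (G.vec b) + overlap (F.vec a) (G.vec b) ^ 2)) =
    2 * (d ^ 2 + d + F.totalOverlap G) := by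
  rw [totalOverlap, ← F.sum_wt_mul_wt G, ← F.sum_wt_mul_wt_mul_overlap_sq G]
  simp only [Finset.mul_sum, ← Finset.sum_add_distrib]
  exact Finset.sum_congr rfl fun a _ => Finset.sum_congr rfl fun b _ => by ring

variable {F : WeightedFrame d α} {G : WeightedFrame d β} {A : POVM (Fin d) ι} {B : POVM (Fin d) κ}
  {r : α → ι} {s : β → κ}

lemma Refines.sum_re_symTrace (hF : F.Refines A r) (hG : G.Refines B s)
    (σ : ι × κ → Matrix (Fin d) (Fin d) ℂ) :
    ∑ p, (symTrace (A.elem p.1) (B.elem p.2) (σ p)).re = ∑ a, ∑ b, F.wt a * G.wt b *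
      (symTrace (ketbra (F.vec a)) (ketbra (G.vec b)) (σ (r a, s b))).re := by
  classical
  rw [Fintype.sum_prod_type, ← Finset.sum_fiberwise _ r]
  refine Finset.sum_congr rfl fun j _ => ?_
  rw [Finset.sum_comm, ← Finset.sum_fiberwise _ s]
  refine Finset.sum_congr rfl fun k _ => ?_
  rw [Finset.sum_comm, hF, hG, re_symTrace_sum_smul_sum_smul]
  refine Finset.sum_congr (by congr) fun a ha => Finset.sum_congr (by congr) fun b hb => ?_
  rw [(Finset.mem_filter.1 ha).2, (Finset.mem_filter.1 hb).2]

variable [NeZero d]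

lemma Refines.averageFidelity_le (hF : F.Refines A r) (hG : G.Refines B s)
    {σ : ι × κ → Matrix (Fin d) (Fin d) ℂ} (hσ : ∀ p, IsDensity (σ p)) :
    averageFidelity (A.prod B) σ ≤
      2 * (d ^ 2 + d + F.totalOverlap G) / (d * (d + 1) * (d + 2)) := by
  rw [averageFidelity_prod, hF.sum_re_symTrace hG, ← sum_wt_mul_wt_mul_fidelity]
  gcongr with a _ b _
  · exact (mul_pos (F.wt_pos a) (G.wt_pos b)).le
  · exact re_symTrace_ketbra_ketbra_le (F.star_dotProduct_vec a) (G.star_dotProduct_vec b)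
      (hσ _).1 (hσ _).2

lemma Refines.estimationFidelity_le (hF : F.Refines A r) (hG : G.Refines B s) :
    estimationFidelity (A.prod B) ≤
      2 * (d ^ 2 + d + F.totalOverlap G) / (d * (d + 1) * (d + 2)) := by
  obtain ⟨σ, hσ⟩ := exists_isDensity d
  refine csSup_le ⟨_, fun _ => σ, fun _ => hσ, rfl⟩ ?_
  rintro _ ⟨σ, hσ, rfl⟩
  exact hF.averageFidelity_le hG hσ

lemma Refines.sicTotalOverlap_le (hF : F.Refines A r) (hG : G.Refines B s)
    (h : estimationFidelity (A.prod B) = F2iid d) : sicTotalOverlap d ≤ F.totalOverlap G := by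
  have hle := hF.estimationFidelity_le hG
  have hd : (0 : ℝ) < d := mod_cast NeZero.pos d
  rw [h, F2iid_eq, div_le_div_iff_of_pos_right (by positivity)] at hle
  linarith

lemma Refines.estimationFidelity_eq {r : α ≃ ι} {s : β ≃ κ} (hF : F.Refines A r)
    (hG : G.Refines B s) : estimationFidelity (A.prod B) =
      2 * (d ^ 2 + d + F.totalOverlap G) / (d * (d + 1) * (d + 2)) := by
  refine IsGreatest.csSup_eq ⟨?_, ?_⟩
  · choose σ hσ0 hσ1 hσ using fun p : ι × κ => exists_re_symTrace_ketbra_ketbra_eq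
      (F.star_dotProduct_vec (r.symm p.1)) (G.star_dotProduct_vec (s.symm p.2))
    refine ⟨σ, fun p => ⟨hσ0 p, hσ1 p⟩, ?_⟩
    have hab (a : α) (b : β) := hσ (r a, s b)
    simp only [Equiv.symm_apply_apply] at hab
    simp only [averageFidelity_prod, hF.sum_re_symTrace hG, hab, sum_wt_mul_wt_mul_fidelity]
  · rintro _ ⟨σ, hσ, rfl⟩
    exact hF.averageFidelity_le hG hσ

end WeightedFrame

section Spectral

variable {d : ℕ} {ι : Type*} [Fintype ι] (A : POVM (Fin d) ι)

/-- The labels of the eigenvectors of the elements of a POVM with nonzero eigenvalues. -/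
abbrev POVM.SpectralIndex : Type _ :=
  {p : ι × Fin d // 0 < (A.posSemidef p.1).isHermitian.eigenvalues p.2}

open Classical in
lemma POVM.elem_eq_sum_spectralIndex (j : ι) :
    A.elem j = ∑ a : A.SpectralIndex with a.1.1 = j,
      (A.posSemidef a.1.1).isHermitian.eigenvalues a.1.2 •
        ketbra ((A.posSemidef a.1.1).isHermitian.eigenvectorBasis a.1.2).ofLp := by
  let f (p : ι × Fin d) : Matrix (Fin d) (Fin d) ℂ := if p.1 = j then
    (A.posSemidef p.1).isHermitian.eigenvalues p.2 •
      ketbra ((A.posSemidef p.1).isHermitian.eigenvectorBasis p.2).ofLp else 0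
  have hzero (p : ι × Fin d) (hp : ¬ 0 < (A.posSemidef p.1).isHermitian.eigenvalues p.2) :
      f p = 0 := by
    simp only [f, le_antisymm (not_lt.1 hp) ((A.posSemidef p.1).eigenvalues_nonneg p.2), zero_smul,
      ite_self]
  rw [Finset.sum_filter]
  refine Eq.trans ?_ (Finset.sum_congr_set
    {p : ι × Fin d | 0 < (A.posSemidef p.1).isHermitian.eigenvalues p.2} f _ (fun _ _ => rfl) hzero)
  rw [Fintype.sum_prod_type, Fintype.sum_eq_single j fun k hk => by simp [f, hk]]
  simp only [f, if_true]
  exact eq_sum_smul_ketbra (A.posSemidef j).isHermitian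

/-- The refinement of a POVM by the spectral projectors of its elements. -/
noncomputable def POVM.spectralFrame : WeightedFrame d A.SpectralIndex where
  wt a := (A.posSemidef a.1.1).isHermitian.eigenvalues a.1.2
  vec a := ((A.posSemidef a.1.1).isHermitian.eigenvectorBasis a.1.2).ofLp
  wt_pos a := a.2
  star_dotProduct_vec a := by
    rw [star_eigenvectorBasis_dotProduct, if_pos rfl]
  sum_eq_one := by
    classical
    rw [← A.sum_eq_one, ← Finset.sum_fiberwise _ fun a : A.SpectralIndex => a.1.1]
    exact Finset.sum_congr rfl fun j _ => (A.elem_eq_sum_spectralIndex j).symm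

lemma POVM.spectralFrame_refines : A.spectralFrame.Refines A fun a => a.1.1 :=
  fun j => A.elem_eq_sum_spectralIndex j

lemma POVM.spectralFrame_injective
    (h : ∀ a b, overlap (A.spectralFrame.vec a) (A.spectralFrame.vec b) ≠ 0) :
    Function.Injective fun a : A.SpectralIndex => a.1.1 := by
  rintro ⟨⟨j, i⟩, hi⟩ ⟨⟨k, l⟩, hl⟩ hjk
  obtain rfl : j = k := hjk
  by_contra hne
  have hil : i ≠ l := fun hil => hne (by simp only [hil])
  refine h ⟨(j, i), hi⟩ ⟨(j, l), hl⟩ ?_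
  change overlap ((A.posSemidef j).isHermitian.eigenvectorBasis i).ofLp
    ((A.posSemidef j).isHermitian.eigenvectorBasis l).ofLp = 0
  rw [overlap, star_eigenvectorBasis_dotProduct, if_neg hil, norm_zero]

end Spectral

section Simple

variable {n ι : Type*} [Fintype n] [DecidableEq n] [Fintype ι] {A : POVM n ι}

lemma POVM.IsSimple.elem_ne_zero [Nonempty n] (hA : A.IsSimple) (j : ι) : A.elem j ≠ 0 := by
  intro h0
  have hother (k : ι) : k = j := by
    by_contra hk
    exact (hA (Ne.symm hk)).ne_zero 0 h0
  have hsum := A.sum_eq_one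
  rw [Finset.sum_eq_zero fun k _ => by rw [hother k, h0]] at hsum
  exact zero_ne_one hsum

lemma POVM.IsSimple.eq_of_smul (hA : A.IsSimple) {j k : ι} {M : Matrix n n ℂ} {a b : ℝ}
    (ha : a ≠ 0) (hj : A.elem j = a • M) (hk : A.elem k = b • M) : j = k := by
  by_contra h
  have hpair := LinearIndependent.pair_iff.1 (hA h) b (-a) (by
    rw [hj, hk, ← Complex.coe_smul, ← Complex.coe_smul, smul_smul, smul_smul, ← add_smul]
    simp [mul_comm])
  exact ha (Complex.ofReal_eq_zero.1 (neg_eq_zero.1 hpair.2))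

end Simple

namespace WeightedFrame

section Equiangular

variable {d : ℕ} {α β : Type*} [Fintype α] [Fintype β] {F : WeightedFrame d α}
  {G : WeightedFrame d β}

/-- The lines of the frame meet pairwise at the angle of a SIC. -/
def IsEquiangular (F : WeightedFrame d α) : Prop :=
  Pairwise fun a b => overlap (F.vec a) (F.vec b) = sicOverlap d

lemma HasSICOverlaps.overlap_ne_zero (h : F.HasSICOverlaps G) (a : α) (b : β) :
    overlap (F.vec a) (G.vec b) ≠ 0 := by
  rcases h a b with h | h <;> rw [h]
  exacts [(sicOverlap_pos d).ne', one_ne_zero]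

lemma IsEquiangular.hasSICOverlaps (h : F.IsEquiangular) : F.HasSICOverlaps F := by
  intro a b
  by_cases hab : a = b
  · exact .inr (by rw [hab, overlap_self (F.star_dotProduct_vec b)])
  · exact .inl (h hab)

lemma HasSICOverlaps.exists_ketbra_eq (h : F.HasSICOverlaps G) (b : β) :
    ∃ a, ketbra (F.vec a) = ketbra (G.vec b) := by
  by_contra! hne
  have hG := G.star_dotProduct_vec b
  have hsq (a : α) : overlap (F.vec a) (G.vec b) ^ 2 = 1 / (d + 1) := by
    rw [(h a b).resolve_right (mt (overlap_eq_one_iff (F.star_dotProduct_vec a) hG).1 (hne a)),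
      sicOverlap_sq]
  have hsum := F.sum_wt_mul_overlap_sq hG
  simp only [hsq, ← Finset.sum_mul, F.sum_wt] at hsum
  field_simp at hsum
  linarith

lemma HasSICOverlaps.right_self (h : F.HasSICOverlaps G) :
    G.HasSICOverlaps G := by
  intro b c
  obtain ⟨a, ha⟩ := h.exists_ketbra_eq b
  rw [← overlap_congr ha rfl]
  exact h a c

variable [NeZero d]

lemma IsEquiangular.injective_ketbra (h : F.IsEquiangular) :
    Function.Injective fun a => ketbra (F.vec a) := by
  intro a b hab
  by_contra hne
  have hone := (overlap_eq_one_iff (F.star_dotProduct_vec a) (F.star_dotProduct_vec b)).2 hab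
  exact sicOverlap_ne_one d ((h hne).symm.trans hone)

lemma IsEquiangular.wt_eq (h : F.IsEquiangular) (a : α) : F.wt a = 1 / d := by
  classical
  have hd := NeZero.ne (d : ℝ)
  have hsum := F.sum_wt
  have hsq := F.sum_wt_mul_overlap_sq (F.star_dotProduct_vec a)
  have hother : ∀ b ∈ Finset.univ.erase a,
      F.wt b * overlap (F.vec b) (F.vec a) ^ 2 = F.wt b * (1 / (d + 1)) := fun b hb => by
    rw [h (Finset.ne_of_mem_erase hb), sicOverlap_sq]
  rw [← Finset.add_sum_erase _ _ (Finset.mem_univ a)] at hsum hsq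
  rw [Finset.sum_congr rfl hother, ← Finset.sum_mul, eq_sub_of_add_eq' hsum,
    overlap_self (F.star_dotProduct_vec a)] at hsq
  field_simp at hsq ⊢
  linarith

lemma IsEquiangular.card_eq (h : F.IsEquiangular) : Fintype.card α = d ^ 2 := by
  have hsum := F.sum_wt
  simp only [h.wt_eq, Finset.sum_const, Finset.card_univ, nsmul_eq_mul] at hsum
  rw [mul_one_div, div_eq_iff (NeZero.ne _), ← sq] at hsum
  exact_mod_cast hsum

lemma HasSICOverlaps.exists_equiv (h : F.HasSICOverlaps G) (hF : F.IsEquiangular)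
    (hG : G.IsEquiangular) : ∃ e : α ≃ β, ∀ a, ketbra (F.vec a) = ketbra (G.vec (e a)) := by
  choose f hf using h.exists_ketbra_eq
  have hinj : Function.Injective f := fun b c hbc =>
    hG.injective_ketbra (by simp only [← hf, hbc])
  have hbij := (Fintype.bijective_iff_injective_and_card f).2
    ⟨hinj, hG.card_eq.trans hF.card_eq.symm⟩
  refine ⟨(Equiv.ofBijective f hbij).symm, fun a => ?_⟩
  rw [← hf, Equiv.ofBijective_apply_symm_apply f hbij]

end Equiangular

section Refines

variable {d : ℕ} {α β ι κ : Type*} [Fintype α] [Fintype β] [Fintype ι] [Fintype κ]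
  {F : WeightedFrame d α} {G : WeightedFrame d β} {A : POVM (Fin d) ι} {B : POVM (Fin d) κ}
  {r : α → ι} {s : β → κ}

lemma refines_equiv_iff {r : α ≃ ι} :
    F.Refines A r ↔ ∀ a, A.elem (r a) = F.wt a • ketbra (F.vec a) := by
  classical
  rw [Refines, ← r.forall_congr_right]
  refine forall_congr' fun a => ?_
  have hfiber : ({b | r b = r a} : Finset α) = {a} := by ext; simp
  rw [hfiber, Finset.sum_singleton]

lemma Refines.surjective (hF : F.Refines A r) (hA : ∀ j, A.elem j ≠ 0) :
    Function.Surjective r := by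
  classical
  intro j
  by_contra! hj
  exact hA j (by rw [hF, Finset.filter_false_of_mem fun a _ => hj a, Finset.sum_empty])

lemma Refines.isEquiangular {r : α ≃ ι} (hF : F.Refines A r) (hA : A.IsSimple)
    (h : F.HasSICOverlaps F) : F.IsEquiangular := by
  rw [refines_equiv_iff] at hF
  refine fun a b hab => (h a b).resolve_right fun hone => hab (r.injective ?_)
  rw [overlap_eq_one_iff (F.star_dotProduct_vec a) (F.star_dotProduct_vec b)] at hone
  exact hA.eq_of_smul (F.wt_pos a).ne' (hF a) (hone ▸ hF b)

lemma Refines.relabel {r : α ≃ ι} (hF : F.Refines A r) (e : ι ≃ κ)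
    (he : ∀ j, A.elem j = B.elem (e j)) : F.Refines B (r.trans e) :=
  refines_equiv_iff.2 fun a => (he (r a)).symm.trans (refines_equiv_iff.1 hF a)

variable [NeZero d]

lemma Refines.isSIC {r : α ≃ ι} (hF : F.Refines A r) (h : F.IsEquiangular) : A.IsSIC := by
  refine ⟨(Fintype.card_congr r).symm.trans h.card_eq, F.vec ∘ r.symm, fun j => ?_, fun j k => ?_⟩
  · obtain ⟨a, rfl⟩ := r.surjective j
    rw [refines_equiv_iff.1 hF, h.wt_eq, ← Complex.coe_smul]
    simp [ketbra]
  · change overlap (F.vec (r.symm j)) (F.vec (r.symm k)) ^ 2 = _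
    split_ifs with hjk
    · rw [hjk, overlap_self (F.star_dotProduct_vec _), mul_one, div_self (by positivity), one_pow]
    · rw [h (r.symm.injective.ne hjk), sicOverlap_sq, mul_zero, zero_add]

lemma Refines.identicalUpToRelabeling {r : α ≃ ι} {s : β ≃ κ} (hF : F.Refines A r)
    (hG : G.Refines B s) (hFe : F.IsEquiangular) (hGe : G.IsEquiangular)
    (h : F.HasSICOverlaps G) : A.IdenticalUpToRelabeling B := by
  obtain ⟨e, he⟩ := h.exists_equiv hFe hGe
  refine ⟨(r.symm.trans e).trans s, fun j => ?_⟩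
  obtain ⟨a, rfl⟩ := r.surjective j
  simp only [Equiv.trans_apply, Equiv.symm_apply_apply]
  rw [refines_equiv_iff.1 hF, refines_equiv_iff.1 hG, hFe.wt_eq, hGe.wt_eq, he]

end Refines

end WeightedFrame

section SIC

variable {d : ℕ} [NeZero d] {ι κ : Type*} [Fintype ι] [Fintype κ] {A : POVM (Fin d) ι}

lemma POVM.IsSimple.isEquiangular_and_exists_refines (hA : A.IsSimple)
    (h : A.spectralFrame.HasSICOverlaps A.spectralFrame) :
    A.spectralFrame.IsEquiangular ∧ ∃ r : A.SpectralIndex ≃ ι, A.spectralFrame.Refines A r := by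
  have hF := A.spectralFrame_refines
  let r := Equiv.ofBijective _
    ⟨A.spectralFrame_injective h.overlap_ne_zero, hF.surjective hA.elem_ne_zero⟩
  have hr : A.spectralFrame.Refines A r := hF
  exact ⟨hr.isEquiangular hA h, r, hr⟩

lemma POVM.IsSIC.exists_refines (hA : A.IsSIC) :
    ∃ F : WeightedFrame d ι, F.Refines A (Equiv.refl ι) ∧ F.IsEquiangular := by
  obtain ⟨-, ψ, hψ, hov⟩ := hA
  have helem (j : ι) : A.elem j = (1 / d : ℝ) • ketbra (ψ j) := by
    rw [hψ, ← Complex.coe_smul]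
    simp [ketbra]
  have hnorm (j : ι) : star (ψ j) ⬝ᵥ ψ j = 1 := by
    have h := hov j j
    rw [if_pos rfl, mul_one, div_self (by positivity),
      pow_eq_one_iff_of_nonneg (norm_nonneg _) two_ne_zero] at h
    rw [Complex.eq_coe_norm_of_nonneg (dotProduct_star_self_nonneg (ψ j)), h, Complex.ofReal_one]
  let F : WeightedFrame d ι :=
    { wt := fun _ => 1 / d
      vec := ψ
      wt_pos := fun _ => one_div_pos.2 (mod_cast NeZero.pos d)
      star_dotProduct_vec := hnorm
      sum_eq_one := by simp only [← helem, A.sum_eq_one] }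
  refine ⟨F, WeightedFrame.refines_equiv_iff.2 helem, fun j k hjk => ?_⟩
  have h := hov j k
  rw [if_neg hjk, mul_zero, zero_add, ← sicOverlap_sq] at h
  exact (sq_eq_sq₀ (overlap_nonneg _ _) (sicOverlap_pos d).le).1 h

lemma POVM.IsSIC.estimationFidelity_eq {B : POVM (Fin d) κ} (hA : A.IsSIC)
    (hAB : A.IdenticalUpToRelabeling B) : estimationFidelity (A.prod B) = F2iid d := by
  obtain ⟨F, hF, hFe⟩ := hA.exists_refines
  obtain ⟨e, he⟩ := hAB
  rw [hF.estimationFidelity_eq (hF.relabel e he), hFe.hasSICOverlaps.totalOverlap_eq, F2iid_eq]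

end SIC

end QMeas

theorem corollary5 {d : ℕ} [NeZero d] {ι κ : Type*} [Fintype ι] [Fintype κ]
    (A : QMeas.POVM (Fin d) ι) (B : QMeas.POVM (Fin d) κ)
    (hA : A.IsSimple) (hB : B.IsSimple) :
    (A.IsSIC ∧ B.IsSIC ∧ A.IdenticalUpToRelabeling B) ↔
      (QMeas.estimationFidelity (A.prod B) = QMeas.estimationFidelity (A.prod A) ∧
        QMeas.estimationFidelity (A.prod A) = QMeas.F2iid d) := by
  constructor
  · rintro ⟨hSIC, -, hAB⟩
    have hAA := hSIC.estimationFidelity_eq ⟨Equiv.refl ι, fun _ => rfl⟩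
    exact ⟨by rw [hAA, hSIC.estimationFidelity_eq hAB], hAA⟩
  · rintro ⟨hAB, hAA⟩
    have hF := A.spectralFrame_refines
    have hG := B.spectralFrame_refines
    have hleAA := hF.sicTotalOverlap_le hF hAA
    have hleAB := hF.sicTotalOverlap_le hG (hAB.trans hAA)
    have hdesign := A.spectralFrame.designDefect_eq_zero_of_sicTotalOverlap_le hleAA
    have hFF := QMeas.WeightedFrame.hasSICOverlaps_of_sicTotalOverlap_le hdesign hleAA
    have hFG := QMeas.WeightedFrame.hasSICOverlaps_of_sicTotalOverlap_le hdesign hleAB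
    obtain ⟨hFe, r, hr⟩ := hA.isEquiangular_and_exists_refines hFF
    obtain ⟨hGe, s, hs⟩ := hB.isEquiangular_and_exists_refines hFG.right_self
    exact ⟨hr.isSIC hFe, hs.isSIC hGe, hr.identicalUpToRelabeling hs hFe hGe hFG⟩
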